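/- Let $J_0(z)=\sum_{m\ge 0}\frac{(-1)^m}{(m!)^2}\left(\frac z2\right)^{2m}$ and $Y_0(z)=\frac2\pi\left(\log\frac z2+\gamma\right)J_0(z)-\frac2\pi\sum_{m\ge 1}\frac{(-1)^m h_m}{(m!)^2}\left(\frac z2\right)^{2m}$, with $h_m=1+\frac12+\dots+\frac1m$, $\gamma$ the Euler–Mascheroni constant and $\log$ the principal logarithm, be the Bessel functions of order zero of the first and second kind, and let $H_0^{(2)}=J_0-iY_0$ be the Hankel function of the second kind of order zero. Let $k\in\mathbb C$ with $\operatorname{Re}k>0$ and $\operatorname{Im}k<0$, and let $S=\{w\in\mathbb C: |\operatorname{Im}w|<|\operatorname{Im}k|\}$. Then there is exactly one continuous function $w\mapsto\sqrt{k^2-w^2}$ on $S$ whose square is $k^2-w^2$ and whose value at $w=0$ is $k$. With this branch, for every $w\in S$ the integral below converges absolutely and $$L(k,w)=\int_0^\infty H_0^{(2)}(kx)\cos(wx)\,dx=\frac1{\sqrt{k^2-w^2}}.$$ -/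

import Mathlib

noncomputable section

/-- The Bessel function of the first kind of order zero,
`J₀(z) = ∑ (-1)^m (z/2)^(2m) / (m!)²`. -/
def besselJZero (z : ℂ) : ℂ :=
  ∑' m : ℕ, (-1 : ℂ) ^ m * (z / 2) ^ (2 * m) / ((m.factorial : ℂ) ^ 2)

/-- The Bessel function of the second kind of order zero, on its principal branch
(cut along the non-positive real axis),
`Y₀(z) = (2/π) (log (z/2) + γ) J₀(z) - (2/π) ∑ (-1)^m h_m (z/2)^(2m) / (m!)²`,
where `h_m = 1 + 1/2 + ⋯ + 1/m` (so the term `m = 0` vanishes). -/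
def besselYZero (z : ℂ) : ℂ :=
  (2 / (Real.pi : ℂ)) * (Complex.log (z / 2) + (Real.eulerMascheroniConstant : ℂ)) * besselJZero z
    - (2 / (Real.pi : ℂ)) *
      ∑' m : ℕ, (-1 : ℂ) ^ m * ((harmonic m : ℚ) : ℂ) * (z / 2) ^ (2 * m) / ((m.factorial : ℂ) ^ 2)

/-- The Hankel function of the second kind of order zero, `H₀⁽²⁾ = J₀ - i Y₀`. -/
def hankelH2Zero (z : ℂ) : ℂ :=
  besselJZero z - Complex.I * besselYZero z

/-- The transform `L(k, w) = ∫₀^∞ H₀⁽²⁾(k x) cos(w x) dx`. -/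
def hankelCosTransform (k w : ℂ) : ℂ :=
  ∫ x in Set.Ioi (0 : ℝ), hankelH2Zero (k * (x : ℂ)) * Complex.cos (w * (x : ℂ))

/-- The horizontal strip `|Im w| < |Im k|`. -/
def horizontalStrip (k : ℂ) : Set ℂ :=
  {w : ℂ | |w.im| < |k.im|}

/-- `s` is, on the strip `|Im w| < |Im k|`, the branch of `√(k² - w²)` that equals `k` at `w = 0`.
(The points `w = ±k` lie outside the strip, so such a continuous root is holomorphic there.) -/
structure IsRootBranch (k : ℂ) (s : ℂ → ℂ) : Prop where
  continuousOn : ContinuousOn s (horizontalStrip k)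
  sq_eq : ∀ w ∈ horizontalStrip k, s w ^ 2 = k ^ 2 - w ^ 2
  at_zero : s 0 = k

end

/-! In the open fourth quadrant, `H₀⁽²⁾(z) = (2i/π) K₀(iz)`, where `K₀(y) = ∫₀^∞ e^{-y cosh t} dt`
for `Re y > 0`. Inserting this turns the transform into a double integral. Since `Re(ik) = |Im k|`,
the strip condition is exactly what makes it absolutely convergent (`integrable_macdonald_mul_cos`).
After Fubini the `x`-integral is an elementary Laplace transform, and with `r = √(k² - w²)/k` what
remains is `∫₀^∞ cosh t/(r² + sinh² t) dt = π/(2r)`, valid because `Re r > 0`.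

The main work is to match the integral `K₀` with the logarithmic series that defines `Y₀`
(`macdonaldIntegral_zero_eq`). Their difference `D` solves the modified Bessel equation and tends to
0 at `0⁺`. A Wronskian argument against `I₀` shows that such a solution vanishes on the positive
axis, and the identity theorem extends this to the right half-plane.

The branch is `k · exp(log(1 - (w/k)²)/2)`: on the strip, `1 - (w/k)²` avoids the cut of the
logarithm. -/

open Filter Topology MeasureTheory Set

/-! ### Entire series and their differential equations -/

/-- The entire function `∑ aₘ qᵐ`, for coefficients with `‖aₘ‖ ≤ 1 / m!`. -/
noncomputable def entireSeries (a : ℕ → ℂ) (q : ℂ) : ℂ := ∑' m : ℕ, a m * q ^ m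

/-- The coefficients of the derivative of a power series. -/
def derivCoeff (a : ℕ → ℂ) (m : ℕ) : ℂ := (m + 1) * a (m + 1)

/-- The bound `1/m!` survives differentiation because `(m+1)/(m+1)! = 1/m!`, so one result on
termwise differentiation covers derivatives of every order. -/
theorem norm_derivCoeff_le {a : ℕ → ℂ} (ha : ∀ m, ‖a m‖ ≤ 1 / (m.factorial : ℝ)) (m : ℕ) :
    ‖derivCoeff a m‖ ≤ 1 / (m.factorial : ℝ) := by
  have h1 : ‖((m : ℂ) + 1)‖ = (m : ℝ) + 1 := by
    exact_mod_cast Complex.norm_natCast (m + 1)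
  rw [derivCoeff, norm_mul, h1]
  calc ((m : ℝ) + 1) * ‖a (m + 1)‖ ≤ (m + 1) * (1 / ((m + 1).factorial : ℝ)) := by
        gcongr; exact ha _
    _ = 1 / (m.factorial : ℝ) := by
        rw [Nat.factorial_succ]; push_cast; field_simp

theorem summable_entireSeries {a : ℕ → ℂ} (ha : ∀ m, ‖a m‖ ≤ 1 / (m.factorial : ℝ)) (q : ℂ) :
    Summable fun m : ℕ => a m * q ^ m := by
  refine Summable.of_norm_bounded (Real.summable_pow_div_factorial ‖q‖) fun m => ?_
  rw [norm_mul, norm_pow]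
  calc ‖a m‖ * ‖q‖ ^ m ≤ 1 / (m.factorial : ℝ) * ‖q‖ ^ m := by gcongr; exact ha _
    _ = _ := by ring

theorem hasDerivAt_entireSeries {a : ℕ → ℂ} (ha : ∀ m, ‖a m‖ ≤ 1 / (m.factorial : ℝ)) (q : ℂ) :
    HasDerivAt (entireSeries a) (entireSeries (derivCoeff a) q) q := by
  set R := ‖q‖ + 1
  have hR : 0 < R := by positivity
  have hu : Summable fun n : ℕ => (n : ℝ) * R ^ (n - 1) / (n.factorial : ℝ) := by
    rw [← summable_nat_add_iff 1]
    refine (Real.summable_pow_div_factorial R).congr fun n => ?_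
    rw [Nat.factorial_succ]; push_cast; field_simp
  have key := hasDerivAt_tsum_of_isPreconnected (g := fun n y => a n * y ^ n)
    (g' := fun n y => a n * (n * y ^ (n - 1))) (y₀ := 0) (y := q) hu (Metric.isOpen_ball (x := (0 : ℂ)) (ε := R))
    (convex_ball _ _).isPreconnected (fun n y _ => (hasDerivAt_pow n y).const_mul (a n))
    (fun n y hy => ?_) (by simp [hR]) (summable_entireSeries ha 0) (by simp [R])
  · refine key.congr_deriv ?_
    have hs : Summable fun n : ℕ => a n * ((n : ℂ) * q ^ (n - 1)) := by
      rw [← summable_nat_add_iff 1]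
      refine (summable_entireSeries (norm_derivCoeff_le ha) q).congr fun n => ?_
      simp [derivCoeff]; ring
    rw [hs.tsum_eq_zero_add, entireSeries]
    simp only [CharP.cast_eq_zero, zero_mul, mul_zero, zero_add]
    refine tsum_congr fun n => ?_
    simp [derivCoeff]; ring
  · have hy' : ‖y‖ ≤ R := by simpa using (Metric.mem_ball.1 hy).le
    rw [norm_mul, norm_mul, norm_pow, Complex.norm_natCast]
    calc ‖a n‖ * (n * ‖y‖ ^ (n - 1)) ≤ 1 / (n.factorial : ℝ) * (n * R ^ (n - 1)) := by
          gcongr; exact ha _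
      _ = _ := by ring

/-- Coefficients of `I₀(2√q)`. -/
noncomputable def besselCoeff (m : ℕ) : ℂ := 1 / (m.factorial : ℂ) ^ 2

/-- Coefficients of the logarithm-free part of `K₀(2√q)`. -/
noncomputable def besselHarmonicCoeff (m : ℕ) : ℂ := ((harmonic m : ℚ) : ℂ) / (m.factorial : ℂ) ^ 2

theorem norm_besselCoeff_le (m : ℕ) : ‖besselCoeff m‖ ≤ 1 / (m.factorial : ℝ) := by
  rw [besselCoeff, norm_div, norm_pow, Complex.norm_natCast, norm_one]
  have : (1 : ℝ) ≤ m.factorial := by exact_mod_cast m.factorial_pos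
  gcongr
  nlinarith

theorem harmonic_le_factorial (m : ℕ) : harmonic m ≤ m.factorial := by
  induction m with
  | zero => simp
  | succ m ih =>
    rcases Nat.eq_zero_or_pos m with rfl | hm
    · simp
    rw [harmonic_succ, Nat.factorial_succ]
    have h1 : (1 : ℚ) ≤ m.factorial := by exact_mod_cast m.factorial_pos
    have h2 : (1 : ℚ) ≤ m := by exact_mod_cast hm
    have h3 : (((m + 1 : ℕ) : ℚ))⁻¹ ≤ 1 := by
      apply inv_le_one_of_one_le₀; push_cast; linarith
    push_cast at *
    nlinarith

theorem norm_besselHarmonicCoeff_le (m : ℕ) :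
    ‖besselHarmonicCoeff m‖ ≤ 1 / (m.factorial : ℝ) := by
  have h0 : 0 ≤ harmonic m := by
    rw [harmonic]; positivity
  have h1 : ‖((harmonic m : ℚ) : ℂ)‖ = ((harmonic m : ℚ) : ℝ) := by
    rw [← Complex.ofReal_ratCast, Complex.norm_real, Real.norm_of_nonneg (by exact_mod_cast h0)]
  have h2 : ((harmonic m : ℚ) : ℝ) ≤ m.factorial := by exact_mod_cast harmonic_le_factorial m
  have : (0 : ℝ) < m.factorial := by exact_mod_cast m.factorial_pos
  rw [besselHarmonicCoeff, norm_div, norm_pow, Complex.norm_natCast, h1,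
    div_le_div_iff₀ (by positivity) this]
  nlinarith

/-- This is the recurrence `(m+1)² aₘ₊₁ = aₘ`; with `q = y²/4` it becomes the modified Bessel
equation of order zero. -/
theorem entireSeries_besselCoeff_ode (q : ℂ) :
    q * entireSeries (derivCoeff (derivCoeff besselCoeff)) q + entireSeries (derivCoeff besselCoeff) q
      = entireSeries besselCoeff q := by
  have h1 := norm_derivCoeff_le norm_besselCoeff_le
  have h2 := norm_derivCoeff_le h1
  simp only [entireSeries]
  rw [(summable_entireSeries h1 q).tsum_eq_zero_add,
    (summable_entireSeries norm_besselCoeff_le q).tsum_eq_zero_add, ← tsum_mul_left,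
    add_left_comm,
    ← ((summable_entireSeries h2 q).mul_left q).tsum_add ((summable_nat_add_iff 1).2
      (summable_entireSeries h1 q))]
  congr 1
  · simp [derivCoeff, besselCoeff]
  · refine tsum_congr fun m => ?_
    have : (m.factorial : ℂ) ≠ 0 := by exact_mod_cast m.factorial_ne_zero
    have h3 : (m : ℂ) + 1 ≠ 0 := by exact_mod_cast m.succ_ne_zero
    have h4 : (m : ℂ) + 1 + 1 ≠ 0 := by exact_mod_cast (m + 1).succ_ne_zero
    simp only [derivCoeff, besselCoeff, Nat.factorial_succ]
    push_cast
    field_simp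
    ring

/-- Comparing coefficients gives `hₘ₊₁ = hₘ + 1/(m+1)`. The extra term on the right is the one that
cancels the cross term from differentiating `log(y/2) · I₀(y)` twice. -/
theorem entireSeries_besselHarmonicCoeff_ode (q : ℂ) :
    q * entireSeries (derivCoeff (derivCoeff besselHarmonicCoeff)) q
        + entireSeries (derivCoeff besselHarmonicCoeff) q
      = entireSeries besselHarmonicCoeff q + entireSeries (derivCoeff besselCoeff) q := by
  have h1 := norm_derivCoeff_le norm_besselHarmonicCoeff_le
  have h2 := norm_derivCoeff_le h1
  have h3 := norm_derivCoeff_le norm_besselCoeff_le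
  simp only [entireSeries]
  rw [← (summable_entireSeries norm_besselHarmonicCoeff_le q).tsum_add (summable_entireSeries h3 q),
    (summable_entireSeries h1 q).tsum_eq_zero_add,
    ((summable_entireSeries norm_besselHarmonicCoeff_le q).add
      (summable_entireSeries h3 q)).tsum_eq_zero_add, ← tsum_mul_left,
    add_left_comm,
    ← ((summable_entireSeries h2 q).mul_left q).tsum_add ((summable_nat_add_iff 1).2
      (summable_entireSeries h1 q))]
  congr 1
  · simp [derivCoeff, besselCoeff, besselHarmonicCoeff]
  · refine tsum_congr fun m => ?_
    have : (m.factorial : ℂ) ≠ 0 := by exact_mod_cast m.factorial_ne_zero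
    have h3 : (m : ℂ) + 1 ≠ 0 := by exact_mod_cast m.succ_ne_zero
    have h4 : (m : ℂ) + 1 + 1 ≠ 0 := by exact_mod_cast (m + 1).succ_ne_zero
    simp only [derivCoeff, besselCoeff, besselHarmonicCoeff, Nat.factorial_succ, harmonic_succ]
    push_cast
    field_simp
    ring

/-- `I₀(2√q) ≥ 1` for `q ≥ 0`, stated through a real-valued version of the series. -/
theorem exists_real_entireSeries_besselCoeff :
    ∃ A : ℝ → ℝ, Continuous A ∧ (∀ q : ℝ, entireSeries besselCoeff (q : ℂ) = (A q : ℂ)) ∧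
      ∀ q, 0 ≤ q → 1 ≤ A q := by
  have hs : ∀ q : ℝ, Summable fun m : ℕ => 1 / (m.factorial : ℝ) ^ 2 * q ^ m := fun q => by
    have := summable_entireSeries norm_besselCoeff_le (q : ℂ)
    rw [← Complex.summable_ofReal]
    simpa [besselCoeff] using this
  have heq : ∀ q : ℝ, entireSeries besselCoeff (q : ℂ)
      = ((∑' m : ℕ, 1 / (m.factorial : ℝ) ^ 2 * q ^ m : ℝ) : ℂ) := fun q => by
    rw [Complex.ofReal_tsum]; simp [besselCoeff, entireSeries]
  refine ⟨fun q => ∑' m : ℕ, 1 / (m.factorial : ℝ) ^ 2 * q ^ m, ?_, heq, fun q hq => ?_⟩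
  · have : (fun q : ℝ => ∑' m : ℕ, 1 / (m.factorial : ℝ) ^ 2 * q ^ m)
        = fun q : ℝ => (entireSeries besselCoeff (q : ℂ)).re := by
      funext q; rw [heq, Complex.ofReal_re]
    rw [this]
    exact Complex.continuous_re.comp ((continuous_iff_continuousAt.2 fun q =>
      (hasDerivAt_entireSeries norm_besselCoeff_le q).continuousAt).comp Complex.continuous_ofReal)
  · have := (hs q).le_tsum 0 (fun m _ => by positivity)
    simpa using this

theorem entireSeries_besselCoeff_zero : entireSeries besselCoeff 0 = 1 := by
  rw [entireSeries, tsum_eq_single 0 (fun m hm => by simp [hm])]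
  simp [besselCoeff]

theorem entireSeries_besselHarmonicCoeff_zero : entireSeries besselHarmonicCoeff 0 = 0 := by
  rw [entireSeries, tsum_eq_single 0 (fun m hm => by simp [hm])]
  simp [besselHarmonicCoeff]

/-! ### The Macdonald integrals and their differential equation -/

theorem half_exp_le_cosh (t : ℝ) : Real.exp t / 2 ≤ Real.cosh t := by
  rw [Real.cosh_eq]; have := Real.exp_pos (-t); linarith

theorem inv_cosh_le (t : ℝ) : (Real.cosh t)⁻¹ ≤ 2 * Real.exp (-t) := by
  rw [inv_le_comm₀ (Real.cosh_pos t) (by positivity), Real.exp_neg, mul_inv, inv_inv]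
  linarith [half_exp_le_cosh t]

theorem integrableOn_inv_cosh : IntegrableOn (fun t : ℝ => (Real.cosh t)⁻¹) (Ioi 0) := by
  refine Integrable.mono' ((integrableOn_exp_neg_Ioi 0).const_mul 2) ?_ (ae_of_all _ fun t => ?_)
  · exact (Real.continuous_cosh.inv₀ fun t => (Real.cosh_pos t).ne').aestronglyMeasurable
  · rw [Real.norm_of_nonneg (inv_nonneg.2 (Real.cosh_pos t).le)]
    exact inv_cosh_le t

/-- One term of the exponential series, `e^x ≥ x^(n+1)/(n+1)!` at `x = a cosh t`, is enough. -/
theorem cosh_pow_mul_exp_le (n : ℕ) {a : ℝ} (ha : 0 < a) (t : ℝ) :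
    Real.cosh t ^ n * Real.exp (-(a * Real.cosh t))
      ≤ ((n + 1).factorial / a ^ (n + 1)) * (Real.cosh t)⁻¹ := by
  have hc := Real.cosh_pos t
  have h := Real.pow_div_factorial_le_exp (x := a * Real.cosh t) (by positivity) (n + 1)
  have hf : (0 : ℝ) < (n + 1).factorial := by exact_mod_cast (n + 1).factorial_pos
  rw [Real.exp_neg, ← div_eq_mul_inv, ← div_eq_mul_inv, div_div, div_le_div_iff₀ (by positivity) (by positivity)]
  rw [div_le_iff₀ hf, mul_pow] at h
  calc Real.cosh t ^ n * (a ^ (n + 1) * Real.cosh t) = a ^ (n + 1) * Real.cosh t ^ (n + 1) := by ring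
    _ ≤ _ := h
    _ = _ := by ring

theorem integrableOn_cosh_pow_mul_exp (n : ℕ) {a : ℝ} (ha : 0 < a) :
    IntegrableOn (fun t : ℝ => Real.cosh t ^ n * Real.exp (-(a * Real.cosh t))) (Ioi 0) := by
  refine Integrable.mono' (integrableOn_inv_cosh.const_mul ((n + 1).factorial / a ^ (n + 1)))
    ?_ (ae_of_all _ fun t => ?_)
  · have : Continuous fun t : ℝ => Real.cosh t ^ n * Real.exp (-(a * Real.cosh t)) := by
      have := Real.continuous_cosh
      fun_prop
    exact this.aestronglyMeasurable
  · rw [Real.norm_of_nonneg (by have := Real.cosh_pos t; positivity)]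
    exact cosh_pow_mul_exp_le n ha t

/-- The integrals `∫₀^∞ coshⁿ t · e^{-y cosh t} dt`; for `n = 0` this is the Macdonald function `K₀(y)`. -/
noncomputable def macdonaldIntegral (n : ℕ) (y : ℂ) : ℂ :=
  ∫ t in Ioi (0 : ℝ), (Real.cosh t : ℂ) ^ n * Complex.exp (-(y * Real.cosh t))

theorem norm_macdonald_integrand (n : ℕ) (y : ℂ) (t : ℝ) :
    ‖(Real.cosh t : ℂ) ^ n * Complex.exp (-(y * Real.cosh t))‖
      = Real.cosh t ^ n * Real.exp (-(y.re * Real.cosh t)) := by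
  rw [norm_mul, norm_pow, Complex.norm_real, Real.norm_of_nonneg (Real.cosh_pos t).le,
    Complex.norm_exp, Complex.neg_re, Complex.re_mul_ofReal]

theorem continuous_macdonald_integrand (n : ℕ) (y : ℂ) :
    Continuous fun t : ℝ => (Real.cosh t : ℂ) ^ n * Complex.exp (-(y * Real.cosh t)) := by
  have := Real.continuous_cosh
  fun_prop

theorem integrableOn_macdonald_integrand (n : ℕ) {y : ℂ} (hy : 0 < y.re) :
    IntegrableOn (fun t : ℝ => (Real.cosh t : ℂ) ^ n * Complex.exp (-(y * Real.cosh t)))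
      (Ioi 0) := by
  refine Integrable.mono' (integrableOn_cosh_pow_mul_exp n hy)
    (continuous_macdonald_integrand n y).aestronglyMeasurable (ae_of_all _ fun t => ?_)
  rw [norm_macdonald_integrand]

theorem hasDerivAt_macdonaldIntegral (n : ℕ) {y : ℂ} (hy : 0 < y.re) :
    HasDerivAt (macdonaldIntegral n) (-macdonaldIntegral (n + 1) y) y := by
  -- On this half-plane the exponential decays at the uniform rate `Re y / 2`, which supplies the
  -- dominating function.
  have hnhds : {z : ℂ | y.re / 2 < z.re} ∈ 𝓝 y :=
    (isOpen_lt continuous_const Complex.continuous_re).mem_nhds (by simp; linarith)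
  have key := hasDerivAt_integral_of_dominated_loc_of_deriv_le (μ := volume.restrict (Ioi (0 : ℝ)))
    (F := fun y t => (Real.cosh t : ℂ) ^ n * Complex.exp (-(y * Real.cosh t)))
    (F' := fun y t => -((Real.cosh t : ℂ) ^ (n + 1) * Complex.exp (-(y * Real.cosh t))))
    (x₀ := y) (bound := fun t => Real.cosh t ^ (n + 1) * Real.exp (-(y.re / 2 * Real.cosh t)))
    hnhds (Eventually.of_forall fun z => (continuous_macdonald_integrand n z).aestronglyMeasurable)
    (integrableOn_macdonald_integrand n hy)
    (continuous_macdonald_integrand (n + 1) y).neg.aestronglyMeasurable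
    (ae_of_all _ fun t z hz => ?_) (integrableOn_cosh_pow_mul_exp (n + 1) (half_pos hy))
    (ae_of_all _ fun t z hz => ?_)
  · refine key.2.congr_deriv ?_
    rw [integral_neg, macdonaldIntegral]
  · have hc := Real.cosh_pos t
    rw [norm_neg, norm_macdonald_integrand]
    gcongr
    exact le_of_lt hz
  · have h1 : HasDerivAt (fun z : ℂ => -(z * (Real.cosh t : ℂ))) (-(1 * (Real.cosh t : ℂ))) z :=
      ((hasDerivAt_id z).mul_const _).neg
    refine (h1.cexp.const_mul _).congr_deriv ?_
    ring

/-- The function `sinh t · e^{-y cosh t}` vanishes at both ends, so its derivative integrates to 0.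
Since `K₀' = -M₁` and `K₀'' = M₂` for the integrals `Mₙ`, this is the modified Bessel equation. -/
theorem macdonaldIntegral_ode {y : ℂ} (hy : 0 < y.re) :
    y * (macdonaldIntegral 2 y - macdonaldIntegral 0 y) = macdonaldIntegral 1 y := by
  have hi0 := integrableOn_macdonald_integrand 0 hy
  have hi1 := integrableOn_macdonald_integrand 1 hy
  have hi2 := integrableOn_macdonald_integrand 2 hy
  have hi20 : IntegrableOn (fun t : ℝ => y * ((Real.cosh t : ℂ) ^ 2 * Complex.exp (-(y * Real.cosh t))
        - (Real.cosh t : ℂ) ^ 0 * Complex.exp (-(y * Real.cosh t)))) (Ioi 0) :=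
    (hi2.sub hi0).const_mul y
  have hi : IntegrableOn (fun t : ℝ =>
      (Real.cosh t : ℂ) ^ 1 * Complex.exp (-(y * Real.cosh t))
      - y * ((Real.cosh t : ℂ) ^ 2 * Complex.exp (-(y * Real.cosh t))
        - (Real.cosh t : ℂ) ^ 0 * Complex.exp (-(y * Real.cosh t)))) (Ioi 0) :=
    hi1.sub hi20
  have hd : ∀ t : ℝ, HasDerivAt (fun t : ℝ => (Real.sinh t : ℂ) * Complex.exp (-(y * Real.cosh t)))
      ((Real.cosh t : ℂ) ^ 1 * Complex.exp (-(y * Real.cosh t))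
      - y * ((Real.cosh t : ℂ) ^ 2 * Complex.exp (-(y * Real.cosh t))
        - (Real.cosh t : ℂ) ^ 0 * Complex.exp (-(y * Real.cosh t)))) t := fun t => by
    have h1 := (Real.hasDerivAt_sinh t).ofReal_comp
    have h0 : HasDerivAt (fun t : ℝ => -(y * (Real.cosh t : ℂ))) (-(y * (Real.sinh t : ℂ))) t :=
      ((Real.hasDerivAt_cosh t).ofReal_comp.const_mul y).neg
    have h2 := h0.cexp
    refine (h1.mul h2).congr_deriv ?_
    have h3 : (Real.cosh t : ℂ) ^ 2 = (Real.sinh t : ℂ) ^ 2 + 1 := by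
      exact_mod_cast Real.cosh_sq t
    rw [h3]; ring
  have hlim : Tendsto (fun t : ℝ => (Real.sinh t : ℂ) * Complex.exp (-(y * Real.cosh t)))
      atTop (𝓝 0) := by
    have hb : Tendsto (fun t : ℝ => ((1 + 1).factorial / y.re ^ (1 + 1)) * (2 * Real.exp (-t)))
        atTop (𝓝 0) := by
      have := (Real.tendsto_exp_neg_atTop_nhds_zero.const_mul 2).const_mul
        (((1 + 1).factorial : ℝ) / y.re ^ (1 + 1))
      simpa using this
    refine squeeze_zero_norm' ?_ hb
    filter_upwards [eventually_ge_atTop 0] with t ht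
    have h1 : ‖(Real.sinh t : ℂ)‖ ≤ Real.cosh t := by
      rw [Complex.norm_real, Real.norm_of_nonneg (Real.sinh_nonneg_iff.2 ht)]
      exact (Real.sinh_lt_cosh t).le
    calc ‖(Real.sinh t : ℂ) * Complex.exp (-(y * Real.cosh t))‖
        ≤ Real.cosh t ^ 1 * Real.exp (-(y.re * Real.cosh t)) := by
          rw [norm_mul, pow_one, Complex.norm_exp, Complex.neg_re, Complex.re_mul_ofReal]
          gcongr
      _ ≤ _ := cosh_pow_mul_exp_le 1 hy t
      _ ≤ _ := by gcongr; exact inv_cosh_le t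
  have key := integral_Ioi_of_hasDerivAt_of_tendsto' (a := 0) (fun t _ => hd t) hi hlim
  rw [integral_sub hi1 hi20, integral_const_mul,
    integral_sub hi2 hi0] at key
  simp only [Real.sinh_zero, Complex.ofReal_zero, zero_mul, sub_zero] at key
  exact (sub_eq_zero.1 key).symm

/-! ### Behaviour of `K₀` at the origin and Euler's constant -/

/-- Both sides are `Γ'(1)`, one of them obtained by differentiating Euler's integral under the
integral sign. -/
theorem integral_log_mul_exp_neg_complex :
    ∫ t in Ioi (0 : ℝ), ((Real.log t * Real.exp (-t) : ℝ) : ℂ)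
      = -(Real.eulerMascheroniConstant : ℂ) := by
  have h1 := Complex.hasDerivAt_GammaIntegral (s := 1) (by simp)
  have h2 : HasDerivAt Complex.GammaIntegral (-(Real.eulerMascheroniConstant : ℂ)) 1 := by
    refine Complex.hasDerivAt_Gamma_one.congr_of_eventuallyEq ?_
    have : {z : ℂ | 0 < z.re} ∈ 𝓝 (1 : ℂ) :=
      (isOpen_lt continuous_const Complex.continuous_re).mem_nhds (by simp)
    filter_upwards [this] with z hz
    exact (Complex.Gamma_eq_integral hz).symm
  rw [← h1.unique h2]
  refine integral_congr_ae (ae_of_all _ fun t => ?_)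
  simp

theorem integral_log_mul_exp_neg :
    ∫ t in Ioi (0 : ℝ), Real.log t * Real.exp (-t) = -Real.eulerMascheroniConstant := by
  have h := integral_log_mul_exp_neg_complex
  rw [integral_complex_ofReal] at h
  exact_mod_cast h

theorem integrableOn_log_mul_exp_neg :
    IntegrableOn (fun t : ℝ => Real.log t * Real.exp (-t)) (Ioi 0) := by
  -- A non-integrable function has integral 0 by convention, whereas the value is `-γ ≠ 0`.
  by_contra h
  have h1 := integral_log_mul_exp_neg
  rw [integral_undef h] at h1
  linarith [Real.one_half_lt_eulerMascheroniConstant]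

theorem integrableOn_exp_neg_div_Ici {ε : ℝ} (hε : 0 < ε) :
    IntegrableOn (fun u : ℝ => Real.exp (-u) / u) (Ici ε) := by
  rw [integrableOn_Ici_iff_integrableOn_Ioi]
  refine Integrable.mono' ((integrableOn_exp_neg_Ioi ε).const_mul ε⁻¹) ?_ ?_
  · exact (by fun_prop : Measurable fun u : ℝ => Real.exp (-u) / u).aestronglyMeasurable
  · filter_upwards [ae_restrict_mem measurableSet_Ioi] with u hu
    have hu' : ε < u := hu
    rw [Real.norm_of_nonneg (by have := hε.trans hu'; positivity), div_eq_inv_mul]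
    gcongr

theorem integral_exp_neg_div {ε : ℝ} (hε : 0 < ε) :
    ∫ u in Ioi ε, Real.exp (-u) / u
      = -(Real.log ε * Real.exp (-ε)) + ∫ u in Ioi ε, Real.log u * Real.exp (-u) := by
  have hi1 := (integrableOn_exp_neg_div_Ici hε).mono_set Ioi_subset_Ici_self
  have hi2 := integrableOn_log_mul_exp_neg.mono_set (Ioi_subset_Ioi hε.le)
  have hlim : Tendsto (fun u : ℝ => Real.log u * Real.exp (-u)) atTop (𝓝 0) := by
    have h := Real.isLittleO_log_id_atTop.isBigO.mul
      (Asymptotics.isBigO_refl (fun u : ℝ => Real.exp (-u)) atTop)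
    refine h.trans_tendsto ?_
    simpa using Real.tendsto_pow_mul_exp_neg_atTop_nhds_zero 1
  have key := integral_Ioi_of_hasDerivAt_of_tendsto' (a := ε)
    (f := fun u : ℝ => Real.log u * Real.exp (-u))
    (f' := fun u : ℝ => Real.exp (-u) / u - Real.log u * Real.exp (-u)) (fun u hu => ?_)
    (hi1.sub hi2) hlim
  · rw [integral_sub hi1 hi2] at key
    linarith
  · have hu0 : u ≠ 0 := (hε.trans_le hu).ne'
    have h1 : HasDerivAt (fun u : ℝ => -u) (-1) u := (hasDerivAt_id u).neg
    refine ((Real.hasDerivAt_log hu0).mul h1.exp).congr_deriv ?_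
    field_simp
    ring

theorem integrableOn_exp_neg_mul_exp {ε : ℝ} (hε : 0 < ε) :
    IntegrableOn (fun t : ℝ => Real.exp (-(ε * Real.exp t))) (Ici 0) := by
  rw [integrableOn_Ici_iff_integrableOn_Ioi]
  refine Integrable.mono' (integrableOn_cosh_pow_mul_exp 0 hε) ?_ ?_
  · exact (by fun_prop : Continuous fun t : ℝ => Real.exp (-(ε * Real.exp t))).aestronglyMeasurable
  · filter_upwards [ae_restrict_mem measurableSet_Ioi] with t ht
    have ht' : (0 : ℝ) < t := ht
    rw [Real.norm_of_nonneg (Real.exp_pos _).le, pow_zero, one_mul]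
    have : Real.cosh t ≤ Real.exp t := by
      rw [Real.cosh_eq]
      have : Real.exp (-t) ≤ Real.exp t := Real.exp_le_exp.2 (by linarith)
      linarith
    gcongr

theorem integral_exp_neg_mul_exp {ε : ℝ} (hε : 0 < ε) :
    ∫ t in Ioi (0 : ℝ), Real.exp (-(ε * Real.exp t)) = ∫ u in Ioi ε, Real.exp (-u) / u := by
  have hsub : (fun t : ℝ => ε * Real.exp t) '' Ici 0 ⊆ Ici ε := by
    rintro _ ⟨t, ht, rfl⟩
    exact le_mul_of_one_le_right hε.le (Real.one_le_exp ht)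
  have hval : ∀ t : ℝ, ((fun u : ℝ => Real.exp (-u) / u) ∘ fun t : ℝ => ε * Real.exp t) t
      * (ε * Real.exp t) = Real.exp (-(ε * Real.exp t)) := fun t => by
    have := Real.exp_pos t
    simp only [Function.comp]
    field_simp
  have key := integral_comp_mul_deriv_Ioi (a := 0) (f := fun t : ℝ => ε * Real.exp t)
    (f' := fun t => ε * Real.exp t) (g := fun u => Real.exp (-u) / u)
    (by fun_prop) (Real.tendsto_exp_atTop.const_mul_atTop hε)
    (fun t _ => ((Real.hasDerivAt_exp t).const_mul ε).hasDerivWithinAt)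
    (ContinuousOn.div (by fun_prop) (by fun_prop) ?_)
    ((integrableOn_exp_neg_div_Ici hε).mono_set hsub)
    (by simp_rw [hval]; exact integrableOn_exp_neg_mul_exp hε)
  · simp_rw [hval] at key
    rw [key]; simp
  · rintro _ ⟨t, _, rfl⟩
    exact (mul_pos hε (Real.exp_pos t)).ne'

/-- The substitution `u = ε eᵗ` and an integration by parts turn the expression into `∫_ε^∞ log u ·
e^{-u} du + log ε · (1 - e^{-ε})`, whose second term vanishes in the limit. -/
theorem tendsto_integral_exp_neg_mul_exp_add_log :
    Tendsto (fun ε : ℝ => (∫ t in Ioi (0 : ℝ), Real.exp (-(ε * Real.exp t))) + Real.log ε)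
      (𝓝[>] 0) (𝓝 (-Real.eulerMascheroniConstant)) := by
  have h1 : Tendsto (fun ε : ℝ => ∫ u in Ioi ε, Real.log u * Real.exp (-u)) (𝓝[>] 0)
      (𝓝 (-Real.eulerMascheroniConstant)) := by
    rw [← integral_log_mul_exp_neg]
    have hc : AECover (volume.restrict (Ioi (0 : ℝ))) (𝓝[>] (0 : ℝ)) fun ε : ℝ => Ioi ε :=
      aecover_Ioi_of_Ioi (tendsto_id.mono_left nhdsWithin_le_nhds)
    refine (hc.integral_tendsto_of_countably_generated integrableOn_log_mul_exp_neg).congr' ?_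
    filter_upwards [self_mem_nhdsWithin] with ε hε
    rw [Measure.restrict_restrict measurableSet_Ioi, Ioi_inter_Ioi, max_eq_left (le_of_lt hε)]
  have h2 : Tendsto (fun ε : ℝ => Real.log ε * (1 - Real.exp (-ε))) (𝓝[>] 0) (𝓝 0) := by
    have hl := (tendsto_log_mul_rpow_nhdsGT_zero zero_lt_one).norm
    rw [norm_zero] at hl
    refine squeeze_zero_norm' ?_ hl
    filter_upwards [self_mem_nhdsWithin] with ε hε
    have hε' : (0 : ℝ) < ε := hε
    rw [norm_mul, norm_mul, Real.rpow_one]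
    gcongr
    rw [Real.norm_of_nonneg (by simpa using hε'.le), Real.norm_of_nonneg hε'.le]
    linarith [Real.add_one_le_exp (-ε)]
  have h3 := h1.add h2
  rw [add_zero] at h3
  refine h3.congr' ?_
  filter_upwards [self_mem_nhdsWithin] with ε hε
  rw [integral_exp_neg_mul_exp hε, integral_exp_neg_div hε]
  ring

theorem macdonaldIntegral_zero_ofReal (x : ℝ) :
    macdonaldIntegral 0 (x : ℂ) = ((∫ t in Ioi (0 : ℝ), Real.exp (-(x * Real.cosh t)) : ℝ) : ℂ) := by
  rw [macdonaldIntegral, ← integral_complex_ofReal]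
  refine integral_congr_ae (ae_of_all _ fun t => ?_)
  simp

/-- As `2ε cosh t = ε eᵗ + ε e^{-t}`, the integrands differ by at most `1 - exp(-ε e^{-t}) ≤ ε
e^{-t}`, which integrates to `ε`. -/
theorem abs_integral_exp_neg_cosh_sub_le {ε : ℝ} (hε : 0 < ε) :
    |(∫ t in Ioi (0 : ℝ), Real.exp (-(2 * ε * Real.cosh t)))
      - ∫ t in Ioi (0 : ℝ), Real.exp (-(ε * Real.exp t))| ≤ ε := by
  have hi1 : IntegrableOn (fun t : ℝ => Real.exp (-(2 * ε * Real.cosh t))) (Ioi 0) := by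
    simpa using integrableOn_cosh_pow_mul_exp 0 (mul_pos two_pos hε)
  have hi2 := (integrableOn_exp_neg_mul_exp hε).mono_set Ioi_subset_Ici_self
  have hb : IntegrableOn (fun t : ℝ => ε * Real.exp (-t)) (Ioi 0) :=
    (integrableOn_exp_neg_Ioi 0).const_mul ε
  rw [← integral_sub hi1 hi2, ← Real.norm_eq_abs]
  refine (norm_integral_le_of_norm_le hb (ae_of_all _ fun t => ?_)).trans_eq ?_
  · have hsplit : -(2 * ε * Real.cosh t) = -(ε * Real.exp t) + -(ε * Real.exp (-t)) := by
      rw [Real.cosh_eq]; ring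
    have h0 : 0 < ε * Real.exp (-t) := by positivity
    have h1 : Real.exp (-(ε * Real.exp t)) ≤ 1 := Real.exp_le_one_iff.2 (by have := Real.exp_pos t; nlinarith)
    have h2 := Real.add_one_le_exp (-(ε * Real.exp (-t)))
    have h3 : Real.exp (-(ε * Real.exp (-t))) ≤ 1 := Real.exp_le_one_iff.2 (by linarith)
    have h4 := Real.exp_pos (-(ε * Real.exp t))
    rw [hsplit, Real.exp_add, Real.norm_eq_abs, abs_le]
    constructor <;> nlinarith
  · rw [integral_const_mul, integral_exp_neg_Ioi_zero, mul_one]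

theorem tendsto_macdonaldIntegral_add_log :
    Tendsto (fun x : ℝ => macdonaldIntegral 0 (x : ℂ) + Complex.log ((x : ℂ) / 2)
      + (Real.eulerMascheroniConstant : ℂ)) (𝓝[>] 0) (𝓝 0) := by
  have hhalf : Tendsto (fun x : ℝ => x / 2) (𝓝[>] 0) (𝓝[>] 0) := by
    refine tendsto_nhdsWithin_iff.2 ⟨?_, ?_⟩
    · have : Tendsto (fun x : ℝ => x / 2) (𝓝 0) (𝓝 (0 / 2)) := tendsto_id.div_const 2
      rw [zero_div] at this
      exact this.mono_left nhdsWithin_le_nhds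
    · filter_upwards [self_mem_nhdsWithin] with x hx
      exact half_pos (show (0 : ℝ) < x from hx)
  have h1 := tendsto_integral_exp_neg_mul_exp_add_log.comp hhalf
  have h2 : Tendsto (fun x : ℝ => (∫ t in Ioi (0 : ℝ), Real.exp (-(x * Real.cosh t)))
      - ∫ t in Ioi (0 : ℝ), Real.exp (-(x / 2 * Real.exp t))) (𝓝[>] 0) (𝓝 0) := by
    refine squeeze_zero_norm' ?_ (hhalf.mono_right nhdsWithin_le_nhds)
    filter_upwards [self_mem_nhdsWithin] with x hx
    have := abs_integral_exp_neg_cosh_sub_le (half_pos (show (0 : ℝ) < x from hx))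
    rwa [mul_div_cancel₀ x two_ne_zero] at this
  have h3 := (h2.add h1).add_const Real.eulerMascheroniConstant
  rw [zero_add, neg_add_cancel] at h3
  have h4 := (Complex.continuous_ofReal.tendsto 0).comp h3
  rw [Complex.ofReal_zero] at h4
  refine h4.congr' ?_
  filter_upwards [self_mem_nhdsWithin] with x hx
  have hx' : (0 : ℝ) < x := hx
  rw [macdonaldIntegral_zero_ofReal, show (x : ℂ) / 2 = ((x / 2 : ℝ) : ℂ) by push_cast; ring,
    ← Complex.ofReal_log (by positivity)]
  simp only [Function.comp]
  push_cast
  ring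

/-! ### Identification of the integral with the logarithmic series -/

/-- The chain rule for an entire series in `y ^ 2 / 4`. -/
theorem hasDerivAt_entireSeries_sq {a : ℕ → ℂ} (ha : ∀ m, ‖a m‖ ≤ 1 / (m.factorial : ℝ)) (y : ℂ) :
    HasDerivAt (fun y : ℂ => entireSeries a (y ^ 2 / 4))
      (y / 2 * entireSeries (derivCoeff a) (y ^ 2 / 4)) y := by
  have h : HasDerivAt (fun y : ℂ => y ^ 2 / 4) (y / 2) y := by
    refine ((hasDerivAt_pow 2 y).div_const 4).congr_deriv ?_
    norm_num; ring
  refine ((hasDerivAt_entireSeries ha (y ^ 2 / 4)).comp y h).congr_deriv ?_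
  ring

/-- The difference between the Macdonald integral and the logarithmic series for `K₀`. -/
noncomputable def macdonaldDefect (y : ℂ) : ℂ :=
  macdonaldIntegral 0 y
    + (Complex.log (y / 2) + (Real.eulerMascheroniConstant : ℂ))
      * entireSeries besselCoeff (y ^ 2 / 4)
    - entireSeries besselHarmonicCoeff (y ^ 2 / 4)

/-- The function `y ↦ y D'(y)` for `D` the defect `macdonaldDefect`. -/
noncomputable def macdonaldDefectEuler (y : ℂ) : ℂ :=
  -(y * macdonaldIntegral 1 y) + entireSeries besselCoeff (y ^ 2 / 4)
    + (Complex.log (y / 2) + (Real.eulerMascheroniConstant : ℂ))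
      * (y ^ 2 / 2 * entireSeries (derivCoeff besselCoeff) (y ^ 2 / 4))
    - y ^ 2 / 2 * entireSeries (derivCoeff besselHarmonicCoeff) (y ^ 2 / 4)

theorem ne_zero_of_re_pos {y : ℂ} (hy : 0 < y.re) : y ≠ 0 := fun h => by simp [h] at hy

theorem hasDerivAt_log_half {y : ℂ} (hy : 0 < y.re) :
    HasDerivAt (fun y : ℂ => Complex.log (y / 2) + (Real.eulerMascheroniConstant : ℂ)) (1 / y) y := by
  have hs : y / 2 ∈ Complex.slitPlane := Complex.mem_slitPlane_iff.2 (Or.inl (by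
    rw [Complex.div_ofNat_re]; linarith))
  have hy0 := ne_zero_of_re_pos hy
  refine ((((hasDerivAt_id y).div_const 2).clog hs).add_const _).congr_deriv ?_
  simp only [id]
  field_simp

theorem hasDerivAt_macdonaldDefect {y : ℂ} (hy : 0 < y.re) :
    HasDerivAt macdonaldDefect (macdonaldDefectEuler y / y) y := by
  have hy0 := ne_zero_of_re_pos hy
  refine (((hasDerivAt_macdonaldIntegral 0 hy).add ((hasDerivAt_log_half hy).mul
    (hasDerivAt_entireSeries_sq norm_besselCoeff_le y))).sub
    (hasDerivAt_entireSeries_sq norm_besselHarmonicCoeff_le y)).congr_deriv ?_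
  rw [macdonaldDefectEuler]
  field_simp
  ring

theorem hasDerivAt_sq_half_mul_entireSeries {a : ℕ → ℂ}
    (ha : ∀ m, ‖a m‖ ≤ 1 / (m.factorial : ℝ)) (y : ℂ) :
    HasDerivAt (fun y : ℂ => y ^ 2 / 2 * entireSeries (derivCoeff a) (y ^ 2 / 4))
      (y * (y ^ 2 / 4 * entireSeries (derivCoeff (derivCoeff a)) (y ^ 2 / 4)
        + entireSeries (derivCoeff a) (y ^ 2 / 4))) y := by
  refine (((hasDerivAt_pow 2 y).div_const 2).mul
    (hasDerivAt_entireSeries_sq (norm_derivCoeff_le ha) y)).congr_deriv ?_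
  norm_num
  ring

/-- With `θ = y d/dy`, this says `θ²D = y²D`: the defect solves the modified Bessel equation. -/
theorem hasDerivAt_macdonaldDefectEuler {y : ℂ} (hy : 0 < y.re) :
    HasDerivAt macdonaldDefectEuler (y * macdonaldDefect y) y := by
  have hy0 := ne_zero_of_re_pos hy
  have hA := hasDerivAt_sq_half_mul_entireSeries norm_besselCoeff_le y
  have hB := hasDerivAt_sq_half_mul_entireSeries norm_besselHarmonicCoeff_le y
  rw [entireSeries_besselCoeff_ode] at hA
  rw [entireSeries_besselHarmonicCoeff_ode] at hB
  refine (((((hasDerivAt_id y).mul (hasDerivAt_macdonaldIntegral 1 hy)).neg.add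
    (hasDerivAt_entireSeries_sq norm_besselCoeff_le y)).add ((hasDerivAt_log_half hy).mul hA)).sub
    hB).congr_deriv ?_
  have hode := macdonaldIntegral_ode hy
  simp only [macdonaldDefect, id]
  field_simp
  linear_combination 2 * hode

/-- Both `D` and `I₀` solve `θ²f = y²f`, so `θD · I₀ - D · θI₀` has zero derivative. -/
theorem exists_wronskian_const : ∃ C : ℂ, ∀ y : ℂ, 0 < y.re →
    macdonaldDefectEuler y * entireSeries besselCoeff (y ^ 2 / 4)
      - macdonaldDefect y * (y ^ 2 / 2 * entireSeries (derivCoeff besselCoeff) (y ^ 2 / 4)) = C := by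
  have hd : ∀ y : ℂ, 0 < y.re → HasDerivAt (fun y =>
      macdonaldDefectEuler y * entireSeries besselCoeff (y ^ 2 / 4)
      - macdonaldDefect y * (y ^ 2 / 2 * entireSeries (derivCoeff besselCoeff) (y ^ 2 / 4))) 0 y := by
    intro y hy
    have hy0 := ne_zero_of_re_pos hy
    have hA := hasDerivAt_sq_half_mul_entireSeries norm_besselCoeff_le y
    rw [entireSeries_besselCoeff_ode] at hA
    refine (((hasDerivAt_macdonaldDefectEuler hy).mul
      (hasDerivAt_entireSeries_sq norm_besselCoeff_le y)).sub
      ((hasDerivAt_macdonaldDefect hy).mul hA)).congr_deriv ?_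
    field_simp
    ring
  exact (isOpen_lt continuous_const Complex.continuous_re).exists_is_const_of_deriv_eq_zero
    (convex_halfSpace_re_gt 0).isPreconnected
    (fun y hy => (hd y hy).differentiableAt.differentiableWithinAt) (fun y hy => (hd y hy).deriv)

theorem tendsto_macdonaldDefect :
    Tendsto (fun x : ℝ => macdonaldDefect (x : ℂ)) (𝓝[>] 0) (𝓝 0) := by
  have hx : Tendsto (fun x : ℝ => (x : ℂ)) (𝓝[>] 0) (𝓝 0) :=
    (Complex.continuous_ofReal.tendsto 0).mono_left nhdsWithin_le_nhds
  -- The logarithm is absorbed by writing `(log(x/2) + γ)(I₀ - 1)` as `((log(x/2) + γ) x) · ((I₀ -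
  -- 1)/x)`; both factors tend to 0.
  have hlog : Tendsto (fun x : ℝ => (Complex.log ((x : ℂ) / 2)
      + (Real.eulerMascheroniConstant : ℂ)) * (x : ℂ)) (𝓝[>] 0) (𝓝 0) := by
    have h1 : Tendsto (fun x : ℝ => ((Real.log x * x ^ (1 : ℝ) : ℝ) : ℂ)) (𝓝[>] 0) (𝓝 0) :=
      (Complex.continuous_ofReal.tendsto 0).comp (tendsto_log_mul_rpow_nhdsGT_zero zero_lt_one)
    have h2 := h1.add (hx.const_mul
      (((Real.eulerMascheroniConstant - Real.log 2 : ℝ) : ℂ)))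
    rw [mul_zero, add_zero] at h2
    refine h2.congr' ?_
    filter_upwards [self_mem_nhdsWithin] with x hx
    have hx' : (0 : ℝ) < x := hx
    rw [show (x : ℂ) / 2 = ((x / 2 : ℝ) : ℂ) by push_cast; ring,
      ← Complex.ofReal_log (by positivity), Real.log_div hx'.ne' two_ne_zero, Real.rpow_one]
    push_cast
    ring
  have hA : Tendsto (fun x : ℝ => (entireSeries besselCoeff ((x : ℂ) ^ 2 / 4) - 1) / (x : ℂ))
      (𝓝[>] 0) (𝓝 0) := by
    have h := (hasDerivAt_iff_tendsto_slope_zero.1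
      (hasDerivAt_entireSeries_sq norm_besselCoeff_le 0))
    have hne : Tendsto (fun x : ℝ => (x : ℂ)) (𝓝[>] 0) (𝓝[≠] 0) :=
      tendsto_nhdsWithin_iff.2 ⟨hx, by
        filter_upwards [self_mem_nhdsWithin] with x hx
        have hx' : (0 : ℝ) < x := hx
        simpa using hx'.ne'⟩
    have h' := h.comp hne
    rw [zero_div, zero_mul] at h'
    refine h'.congr fun x => ?_
    simp [entireSeries_besselCoeff_zero, div_eq_inv_mul]
  have hB : Tendsto (fun x : ℝ => entireSeries besselHarmonicCoeff ((x : ℂ) ^ 2 / 4))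
      (𝓝[>] 0) (𝓝 0) := by
    have h := ((hasDerivAt_entireSeries_sq norm_besselHarmonicCoeff_le 0).continuousAt.tendsto).comp hx
    simpa [entireSeries_besselHarmonicCoeff_zero, Function.comp_def] using h
  have h := (tendsto_macdonaldIntegral_add_log.add (hlog.mul hA)).sub hB
  rw [mul_zero, add_zero, sub_zero] at h
  refine h.congr' ?_
  filter_upwards [self_mem_nhdsWithin] with x hx
  have hx' : (x : ℂ) ≠ 0 := by exact_mod_cast (show (0 : ℝ) < x from hx).ne'
  rw [macdonaldDefect]
  field_simp
  ring

/-- Reduction of order: `c = D/I₀` satisfies `c' = C/(x I₀²)` and tends to 0 at `0⁺`. A nonzero `C`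
would make `c` diverge logarithmically, so `C = 0`, and `c` is constant with limit 0. -/
theorem macdonaldDefect_ofReal {x : ℝ} (hx : 0 < x) : macdonaldDefect (x : ℂ) = 0 := by
  obtain ⟨C, hC⟩ := exists_wronskian_const
  obtain ⟨A, hAcont, hA, hA1⟩ := exists_real_entireSeries_besselCoeff
  have hval : ∀ x : ℝ, entireSeries besselCoeff ((x : ℂ) ^ 2 / 4) = (A (x ^ 2 / 4) : ℂ) :=
    fun x => by rw [← hA]; push_cast; rfl
  have hApos : ∀ x : ℝ, 0 < A (x ^ 2 / 4) := fun x =>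
    zero_lt_one.trans_le (hA1 _ (by positivity))
  set c : ℝ → ℂ := fun x => macdonaldDefect (x : ℂ) / entireSeries besselCoeff ((x : ℂ) ^ 2 / 4)
    with hc
  have hcd : ∀ x : ℝ, 0 < x → HasDerivAt c (C * ((x * A (x ^ 2 / 4) ^ 2 : ℝ) : ℂ)⁻¹) x := by
    intro x hx
    have hxc : (x : ℂ) ≠ 0 := by exact_mod_cast hx.ne'
    have hne : entireSeries besselCoeff ((x : ℂ) ^ 2 / 4) ≠ 0 := by
      rw [hval]; exact_mod_cast (hApos x).ne'
    have h := ((hasDerivAt_macdonaldDefect (y := x) (by simpa using hx)).div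
      (hasDerivAt_entireSeries_sq norm_besselCoeff_le (x : ℂ)) hne).comp_ofReal
    refine h.congr_deriv ?_
    rw [← hC x (by simpa using hx)]
    push_cast
    rw [← hval]
    field_simp
  have hlim : Tendsto c (𝓝[>] 0) (𝓝 0) := by
    have h0 : Tendsto (fun x : ℝ => entireSeries besselCoeff ((x : ℂ) ^ 2 / 4)) (𝓝[>] 0) (𝓝 1) := by
      have h := ((hasDerivAt_entireSeries_sq norm_besselCoeff_le 0).continuousAt.tendsto).comp
        ((Complex.continuous_ofReal.tendsto 0).mono_left (nhdsWithin_le_nhds (s := Ioi 0)))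
      simpa [entireSeries_besselCoeff_zero, Function.comp_def] using h
    have h := tendsto_macdonaldDefect.div h0 one_ne_zero
    rw [zero_div] at h
    exact h
  have hC0 : C = 0 := by
    by_contra hC0
    set g : ℝ → ℝ := fun x => (c x / C).re with hg
    have hgd : ∀ x : ℝ, 0 < x → HasDerivAt g (x * A (x ^ 2 / 4) ^ 2)⁻¹ x := fun x hx => by
      have h := ((hcd x hx).div_const C)
      have h' := Complex.reCLM.hasFDerivAt.comp_hasDerivAt x h
      refine h'.congr_deriv ?_
      rw [mul_div_right_comm, div_self hC0, one_mul, ← Complex.ofReal_inv]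
      exact Complex.ofReal_re _
    have hglim : Tendsto g (𝓝[>] 0) (𝓝 0) := by
      have := (Complex.continuous_re.tendsto _).comp (hlim.div_const C)
      rw [zero_div, Complex.zero_re] at this
      exact this
    have hdouble : Tendsto (fun x : ℝ => 2 * x) (𝓝[>] 0) (𝓝[>] 0) := by
      refine tendsto_nhdsWithin_iff.2 ⟨?_, ?_⟩
      · have : Tendsto (fun x : ℝ => 2 * x) (𝓝 0) (𝓝 (2 * 0)) := tendsto_id.const_mul 2
        rw [mul_zero] at this
        exact this.mono_left nhdsWithin_le_nhds
      · filter_upwards [self_mem_nhdsWithin] with x hx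
        exact mul_pos two_pos (show (0 : ℝ) < x from hx)
    have hdiff : Tendsto (fun x => g (2 * x) - g x) (𝓝[>] 0) (𝓝 0) := by
      simpa using (hglim.comp hdouble).sub hglim
    obtain ⟨M, hM⟩ := (isCompact_Icc (a := (0 : ℝ)) (b := 1)).exists_bound_of_continuousOn
      hAcont.continuousOn
    have hM1 : 1 ≤ M := (hA1 0 le_rfl).trans ((le_abs_self _).trans (hM 0 (by simp)))
    -- The mean value theorem on `[x, 2x]` gives the increment `x/(ξ A²)` with `ξ < 2x` and `A ≤ M`.
    -- Doubling `x` thus raises `g` by a fixed amount, which contradicts `g → 0`.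
    have hlow : ∀ᶠ x in 𝓝[>] (0 : ℝ), 1 / (2 * M ^ 2) ≤ g (2 * x) - g x := by
      filter_upwards [Ioo_mem_nhdsGT (zero_lt_one (α := ℝ))] with x hx
      obtain ⟨ξ, hξ, hslope⟩ := exists_hasDerivAt_eq_slope g (fun x => (x * A (x ^ 2 / 4) ^ 2)⁻¹)
        (show x < 2 * x by linarith [hx.1])
        (fun z hz => (hgd z (hx.1.trans_le hz.1)).continuousAt.continuousWithinAt)
        (fun z hz => hgd z (hx.1.trans hz.1))
      have hx0 := hx.1
      have hξ0 : 0 < ξ := hx0.trans hξ.1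
      have hξ2 : ξ < 2 := by linarith [hξ.2, hx.2]
      have hAM : A (ξ ^ 2 / 4) ≤ M :=
        (le_abs_self _).trans (hM _ ⟨by positivity, by nlinarith⟩)
      have hAp := hApos ξ
      have e : g (2 * x) - g x = x * (ξ * A (ξ ^ 2 / 4) ^ 2)⁻¹ := by
        rw [hslope]; field_simp; ring
      rw [e, ← div_eq_mul_inv, div_le_div_iff₀ (by positivity) (by positivity), one_mul]
      calc ξ * A (ξ ^ 2 / 4) ^ 2 ≤ (2 * x) * M ^ 2 := by
            gcongr
            exact hξ.2.le
        _ = _ := by ring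
    have := ge_of_tendsto hdiff hlow
    have : 0 < 1 / (2 * M ^ 2) := by positivity
    linarith
  have hconst : ∀ z : ℝ, 0 < z → c z = c x := fun z hz => by
    refine (isOpen_Ioi (a := (0 : ℝ))).is_const_of_deriv_eq_zero isPreconnected_Ioi
      (fun u hu => (hcd u hu).differentiableAt.differentiableWithinAt) (fun u hu => ?_) hz hx
    rw [(hcd u hu).deriv, hC0, zero_mul]; rfl
  have hcx : c x = 0 := by
    refine tendsto_nhds_unique (tendsto_const_nhds.congr' ?_) hlim
    filter_upwards [self_mem_nhdsWithin] with z hz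
    exact (hconst z hz).symm
  have hne : entireSeries besselCoeff ((x : ℂ) ^ 2 / 4) ≠ 0 := by
    rw [hval]; exact_mod_cast (hApos x).ne'
  simpa [hc, hne] using hcx

theorem macdonaldDefect_eq_zero {y : ℂ} (hy : 0 < y.re) : macdonaldDefect y = 0 := by
  have hopen : IsOpen {z : ℂ | 0 < z.re} := isOpen_lt continuous_const Complex.continuous_re
  have hf : AnalyticOnNhd ℂ macdonaldDefect {z : ℂ | 0 < z.re} :=
    DifferentiableOn.analyticOnNhd (fun z hz =>
      (hasDerivAt_macdonaldDefect hz).differentiableAt.differentiableWithinAt) hopen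
  refine hf.eqOn_zero_of_preconnected_of_frequently_eq_zero
    (convex_halfSpace_re_gt 0).isPreconnected (z₀ := 1) (by simp) ?_ hy
  -- The real zeros `1 + x` accumulate at 1, as the identity theorem requires.
  have ht : Tendsto (fun x : ℝ => ((1 + x : ℝ) : ℂ)) (𝓝[>] 0) (𝓝[≠] 1) := by
    refine tendsto_nhdsWithin_iff.2 ⟨?_, ?_⟩
    · have : Tendsto (fun x : ℝ => ((1 + x : ℝ) : ℂ)) (𝓝 0) (𝓝 ((1 + 0 : ℝ) : ℂ)) :=
        (by fun_prop : Continuous fun x : ℝ => ((1 + x : ℝ) : ℂ)).tendsto 0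
      rw [add_zero, Complex.ofReal_one] at this
      exact this.mono_left nhdsWithin_le_nhds
    · filter_upwards [self_mem_nhdsWithin] with x hx
      have hx' : (0 : ℝ) < x := hx
      simpa using hx'.ne'
  refine ht.frequently (Eventually.frequently ?_)
  filter_upwards [self_mem_nhdsWithin] with x hx
  have hx' : (0 : ℝ) < x := hx
  exact macdonaldDefect_ofReal (by linarith)

theorem macdonaldIntegral_zero_eq {y : ℂ} (hy : 0 < y.re) :
    macdonaldIntegral 0 y =
      -(Complex.log (y / 2) + (Real.eulerMascheroniConstant : ℂ))
        * entireSeries besselCoeff (y ^ 2 / 4) + entireSeries besselHarmonicCoeff (y ^ 2 / 4) := by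
  have h := macdonaldDefect_eq_zero hy
  rw [macdonaldDefect] at h
  linear_combination h

/-! ### Laplace transform of the cosine and absolute convergence -/

theorem integral_cos_mul_exp {p w : ℂ} (h : |w.im| < p.re) :
    ∫ x in Ioi (0 : ℝ), Complex.exp (-(p * x)) * Complex.cos (w * x) = p / (p ^ 2 + w ^ 2) := by
  obtain ⟨h1, h2⟩ := abs_lt.1 h
  have ha : (-p + w * Complex.I).re < 0 := by simp; linarith
  have hb : (-p - w * Complex.I).re < 0 := by simp; linarith
  have hna : -p + w * Complex.I ≠ 0 := fun h => by simp [h] at ha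
  have hnb : -p - w * Complex.I ≠ 0 := fun h => by simp [h] at hb
  have hfac : p ^ 2 + w ^ 2 = (-p + w * Complex.I) * (-p - w * Complex.I) := by
    linear_combination w ^ 2 * Complex.I_sq
  have heq : ∀ x : ℝ, Complex.exp (-(p * x)) * Complex.cos (w * x)
      = (Complex.exp ((-p + w * Complex.I) * x) + Complex.exp ((-p - w * Complex.I) * x)) / 2 :=
    fun x => by
      rw [Complex.cos, mul_div_assoc', mul_add, ← Complex.exp_add, ← Complex.exp_add]
      ring_nf
  simp_rw [heq]
  rw [integral_div, integral_add (integrableOn_exp_mul_complex_Ioi ha 0)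
    (integrableOn_exp_mul_complex_Ioi hb 0), integral_exp_mul_complex_Ioi ha,
    integral_exp_mul_complex_Ioi hb, hfac]
  simp only [Complex.ofReal_zero, mul_zero, Complex.exp_zero]
  field_simp
  ring

theorem norm_cos_mul_ofReal_le (w : ℂ) {x : ℝ} (hx : 0 ≤ x) :
    ‖Complex.cos (w * x)‖ ≤ Real.exp (|w.im| * x) := by
  have h1 : ‖Complex.exp (w * x * Complex.I)‖ ≤ Real.exp (|w.im| * x) := by
    rw [Complex.norm_exp]
    apply Real.exp_le_exp.2
    simp
    nlinarith [neg_abs_le w.im]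
  have h2 : ‖Complex.exp (-(w * x) * Complex.I)‖ ≤ Real.exp (|w.im| * x) := by
    rw [Complex.norm_exp]
    apply Real.exp_le_exp.2
    simp
    nlinarith [le_abs_self w.im]
  rw [Complex.cos, norm_div, Complex.norm_ofNat]
  linarith [norm_add_le (Complex.exp (w * x * Complex.I)) (Complex.exp (-(w * x) * Complex.I))]

/-- Since `cosh t ≥ 1`, the growth `e^{|Im w| x}` costs at most `e^{|Im w| x cosh t}`, which leaves
the majorant `e^{-c x cosh t}`. Integrating in `x` first gives `1/(c cosh t)`, which is integrable.
-/
theorem integrable_macdonald_mul_cos {a w : ℂ} (h : |w.im| < a.re) :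
    Integrable (fun z : ℝ × ℝ => Complex.exp (-(a * Real.cosh z.2 * z.1)) * Complex.cos (w * z.1))
      ((volume.restrict (Ioi (0 : ℝ))).prod (volume.restrict (Ioi (0 : ℝ)))) := by
  set c := a.re - |w.im|
  have hc : 0 < c := sub_pos.2 h
  have hcont : Continuous fun z : ℝ × ℝ =>
      Complex.exp (-(a * Real.cosh z.2 * z.1)) * Complex.cos (w * z.1) := by
    have := Real.continuous_cosh
    fun_prop
  have hpos : ∀ᵐ z : ℝ × ℝ ∂((volume.restrict (Ioi (0 : ℝ))).prod (volume.restrict (Ioi (0 : ℝ)))),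
      0 < z.1 := by
    rw [Measure.prod_restrict]
    filter_upwards [ae_restrict_mem (measurableSet_Ioi.prod measurableSet_Ioi)] with z hz
    exact hz.1
  have hbound : Integrable (fun z : ℝ × ℝ => Real.exp (-(c * Real.cosh z.2) * z.1))
      ((volume.restrict (Ioi (0 : ℝ))).prod (volume.restrict (Ioi (0 : ℝ)))) := by
    have hcont' : Continuous fun z : ℝ × ℝ => Real.exp (-(c * Real.cosh z.2) * z.1) := by
      have := Real.continuous_cosh
      fun_prop
    refine (integrable_prod_iff' hcont'.aestronglyMeasurable).2 ⟨ae_of_all _ fun t => ?_, ?_⟩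
    · exact integrableOn_exp_mul_Ioi (neg_neg_of_pos (mul_pos hc (Real.cosh_pos t))) 0
    · refine (integrableOn_inv_cosh.const_mul c⁻¹).congr (ae_of_all _ fun t => ?_)
      have hct := Real.cosh_pos t
      simp only [Real.norm_eq_abs, Real.abs_exp]
      rw [integral_exp_mul_Ioi (neg_neg_of_pos (mul_pos hc hct))]
      simp only [mul_zero, Real.exp_zero]
      field_simp
  refine hbound.mono' hcont.aestronglyMeasurable ?_
  filter_upwards [hpos] with z hz
  have h1 := Real.one_le_cosh z.2
  calc ‖Complex.exp (-(a * Real.cosh z.2 * z.1)) * Complex.cos (w * z.1)‖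
      ≤ Real.exp (-(a.re * Real.cosh z.2 * z.1)) * Real.exp (|w.im| * z.1) := by
        rw [norm_mul, Complex.norm_exp, Complex.neg_re, Complex.re_mul_ofReal,
          Complex.re_mul_ofReal]
        gcongr
        exact norm_cos_mul_ofReal_le w hz.le
    _ ≤ _ := by
        rw [← Real.exp_add]
        apply Real.exp_le_exp.2
        have : |w.im| * z.1 ≤ |w.im| * z.1 * Real.cosh z.2 :=
          le_mul_of_one_le_right (by positivity) h1
        simp only [c]
        nlinarith

/-! ### The remaining elementary integral -/

theorem integral_cosh_div_sq_add_sinh_sq {r : ℂ} (hr : 0 < r.re)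
    (hi : IntegrableOn (fun t : ℝ => (Real.cosh t : ℂ) / (r ^ 2 + (Real.sinh t : ℂ) ^ 2)) (Ioi 0)) :
    ∫ t in Ioi (0 : ℝ), (Real.cosh t : ℂ) / (r ^ 2 + (Real.sinh t : ℂ) ^ 2) = Real.pi / (2 * r) := by
  have hr0 : r ≠ 0 := fun h => by simp [h] at hr
  -- This is `arctan(sinh t / r)/r` written with logarithms. As `Re r > 0`, both arguments stay in
  -- the right half-plane, so no cut is crossed.
  set F : ℝ → ℂ := fun t => (Complex.I / (2 * r)) *
    (Complex.log (r - Complex.I * Real.sinh t) - Complex.log (r + Complex.I * Real.sinh t)) with hF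
  have hm : ∀ u : ℝ, r - Complex.I * u ∈ Complex.slitPlane := fun u =>
    Complex.mem_slitPlane_iff.2 (Or.inl (by simpa using hr))
  have hp : ∀ u : ℝ, r + Complex.I * u ∈ Complex.slitPlane := fun u =>
    Complex.mem_slitPlane_iff.2 (Or.inl (by simpa using hr))
  have hd : ∀ t : ℝ, HasDerivAt F ((Real.cosh t : ℂ) / (r ^ 2 + (Real.sinh t : ℂ) ^ 2)) t := by
    intro t
    have h0 := ((Real.hasDerivAt_sinh t).ofReal_comp).const_mul Complex.I
    have h1 := (h0.const_sub r).clog_real (hm _)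
    have h2 := (h0.const_add r).clog_real (hp _)
    refine ((h1.sub h2).const_mul _).congr_deriv ?_
    have n1 := Complex.slitPlane_ne_zero (hm (Real.sinh t))
    have n2 := Complex.slitPlane_ne_zero (hp (Real.sinh t))
    have hfac : r ^ 2 + (Real.sinh t : ℂ) ^ 2
        = (r - Complex.I * Real.sinh t) * (r + Complex.I * Real.sinh t) := by
      linear_combination ((Real.sinh t : ℂ) ^ 2) * Complex.I_sq
    rw [hfac]
    field_simp
    linear_combination (-2 * r * (Real.cosh t : ℂ)) * Complex.I_sq
  have hlim : Tendsto F atTop (𝓝 (Real.pi / (2 * r))) := by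
    -- Pulling the positive factor `sinh t` out of both logarithms leaves limits `log(∓i) = ∓iπ/2`.
    have hs : Tendsto Real.sinh atTop atTop := Real.sinhOrderIso.tendsto_atTop
    have hinv : Tendsto (fun t : ℝ => r / (Real.sinh t : ℂ)) atTop (𝓝 0) := by
      have := ((Complex.continuous_ofReal.tendsto 0).comp (tendsto_inv_atTop_zero.comp hs)).const_mul r
      rw [Complex.ofReal_zero, mul_zero] at this
      refine this.congr fun t => ?_
      simp [div_eq_mul_inv]
    have hl1 : Tendsto (fun t : ℝ => Complex.log (r / (Real.sinh t : ℂ) - Complex.I)) atTop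
        (𝓝 (Complex.log (0 - Complex.I))) :=
      (hinv.sub_const _).clog (by simp [Complex.mem_slitPlane_iff])
    have hl2 : Tendsto (fun t : ℝ => Complex.log (r / (Real.sinh t : ℂ) + Complex.I)) atTop
        (𝓝 (Complex.log (0 + Complex.I))) :=
      (hinv.add_const _).clog (by simp [Complex.mem_slitPlane_iff])
    have h := (hl1.sub hl2).const_mul (Complex.I / (2 * r))
    rw [zero_sub, zero_add, Complex.log_neg_I, Complex.log_I,
      show Complex.I / (2 * r) * (-(↑Real.pi / 2) * Complex.I - ↑Real.pi / 2 * Complex.I)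
        = Real.pi / (2 * r) by
          field_simp; linear_combination (-2 : ℂ) * Complex.I_sq] at h
    refine h.congr' ?_
    filter_upwards [eventually_gt_atTop 0] with t ht
    have hst : 0 < Real.sinh t := Real.sinh_pos_iff.2 ht
    have hst0 : (Real.sinh t : ℂ) ≠ 0 := by exact_mod_cast hst.ne'
    have e1 : r - Complex.I * Real.sinh t = (Real.sinh t : ℂ) * (r / Real.sinh t - Complex.I) := by
      field_simp
    have e2 : r + Complex.I * Real.sinh t = (Real.sinh t : ℂ) * (r / Real.sinh t + Complex.I) := by
      field_simp
    have n1 : r / Real.sinh t - Complex.I ≠ 0 := fun h0 => by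
      apply Complex.slitPlane_ne_zero (hm (Real.sinh t)); rw [e1, h0, mul_zero]
    have n2 : r / Real.sinh t + Complex.I ≠ 0 := fun h0 => by
      apply Complex.slitPlane_ne_zero (hp (Real.sinh t)); rw [e2, h0, mul_zero]
    simp only [hF]
    rw [e1, e2, Complex.log_ofReal_mul hst n1, Complex.log_ofReal_mul hst n2]
    ring
  rw [integral_Ioi_of_hasDerivAt_of_tendsto' (fun t _ => hd t) hi hlim]
  simp [hF]

/-! ### The Hankel function as a Macdonald integral -/

theorem hankelH2Zero_eq_macdonaldIntegral {z : ℂ} (hre : 0 < z.re) (him : z.im < 0) :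
    hankelH2Zero z = 2 * Complex.I / Real.pi * macdonaldIntegral 0 (Complex.I * z) := by
  have hy : 0 < (Complex.I * z).re := by simpa using him
  have hq : (Complex.I * z) ^ 2 / 4 = (-1) * (z / 2) ^ 2 := by
    linear_combination z ^ 2 / 4 * Complex.I_sq
  have hJ : besselJZero z = entireSeries besselCoeff ((Complex.I * z) ^ 2 / 4) := by
    rw [hq, besselJZero, entireSeries]
    refine tsum_congr fun m => ?_
    rw [besselCoeff, mul_pow, pow_mul]
    ring
  have hT : ∑' m : ℕ, (-1 : ℂ) ^ m * ((harmonic m : ℚ) : ℂ) * (z / 2) ^ (2 * m)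
      / ((m.factorial : ℂ) ^ 2) = entireSeries besselHarmonicCoeff ((Complex.I * z) ^ 2 / 4) := by
    rw [hq, entireSeries]
    refine tsum_congr fun m => ?_
    rw [besselHarmonicCoeff, mul_pow, pow_mul]
    ring
  have hz2 : 0 < (z / 2).re := by rw [Complex.div_ofNat_re]; linarith
  -- No multiple of `2πi` appears because `arg(z/2)` lies in `(-π/2, π/2)`. The term `iπ/2` is what
  -- produces the `J₀` part of `H₀⁽²⁾`.
  have hlog : Complex.log (Complex.I * z / 2) = Real.pi / 2 * Complex.I + Complex.log (z / 2) := by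
    rw [mul_div_assoc, ← Complex.log_I]
    refine (Complex.log_mul_eq_add_log_iff Complex.I_ne_zero (ne_zero_of_re_pos hz2)).2 ?_
    obtain ⟨h1, h2⟩ := abs_lt.1 (Complex.abs_arg_lt_pi_div_two_iff.2 (Or.inl hz2))
    rw [Complex.arg_I]
    constructor <;> linarith [Real.pi_pos]
  have hpi : (Real.pi : ℂ) ≠ 0 := by exact_mod_cast Real.pi_ne_zero
  rw [macdonaldIntegral_zero_eq hy, hlog, hankelH2Zero, besselYZero, hT, hJ]
  generalize entireSeries besselCoeff ((Complex.I * z) ^ 2 / 4) = A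
  field_simp
  linear_combination (A * Real.pi) * Complex.I_sq

/-! ### The branch of the square root -/

/-- The branch of `√(k² - w²)` with value `k` at `w = 0`, obtained from the principal logarithm. -/
noncomputable def sqrtBranch (k w : ℂ) : ℂ := k * Complex.exp (Complex.log (1 - (w / k) ^ 2) / 2)

/-- If `1 - u² ≤ 0` with `u = w/k`, then `u` is real and `|u| ≥ 1`, so `|Im w| = |u| |Im k| ≥ |Im
k|`, outside the strip. -/
theorem one_sub_div_sq_mem_slitPlane {k w : ℂ} (hk : k.im ≠ 0) (hw : w ∈ horizontalStrip k) :
    1 - (w / k) ^ 2 ∈ Complex.slitPlane := by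
  have hk0 : k ≠ 0 := fun h => hk (by simp [h])
  set u := w / k with hu
  have hwu : w = u * k := by rw [hu, div_mul_cancel₀ _ hk0]
  rw [Complex.mem_slitPlane_iff]
  by_contra! h
  obtain ⟨h1, h2⟩ := h
  simp only [pow_two, Complex.sub_re, Complex.one_re, Complex.mul_re, Complex.sub_im,
    Complex.one_im, Complex.mul_im] at h1 h2
  have hre : u.re ≠ 0 := fun h0 => by rw [h0] at h1; nlinarith [mul_self_nonneg u.im]
  have him : u.im = 0 := by
    have : u.re * u.im = 0 := by linarith
    exact (mul_eq_zero.1 this).resolve_left hre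
  have hone : 1 ≤ |u.re| := by
    rw [him] at h1
    by_contra! hlt
    have := abs_mul_abs_self u.re
    nlinarith [abs_nonneg u.re]
  have hstrip : |w.im| < |k.im| := hw
  rw [hwu, Complex.mul_im, him, zero_mul, add_zero, abs_mul] at hstrip
  nlinarith [abs_nonneg k.im]

theorem sqrtBranch_sq {k w : ℂ} (hk : k.im ≠ 0) (hw : w ∈ horizontalStrip k) :
    sqrtBranch k w ^ 2 = k ^ 2 - w ^ 2 := by
  have hk0 : k ≠ 0 := fun h => hk (by simp [h])
  rw [sqrtBranch, mul_pow, ← Complex.exp_nat_mul, Nat.cast_ofNat, mul_div_cancel₀ _ two_ne_zero,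
    Complex.exp_log (Complex.slitPlane_ne_zero (one_sub_div_sq_mem_slitPlane hk hw))]
  field_simp

theorem sqrtBranch_ne_zero {k w : ℂ} (hk : k.im ≠ 0) : sqrtBranch k w ≠ 0 :=
  mul_ne_zero (fun h => hk (by simp [h])) (Complex.exp_ne_zero _)

/-- The argument of `1 - (w/k)²` lies in `(-π, π)`, and halving it lands in the right half-plane.
This fixes the sign of the root in the final integral. -/
theorem re_sqrtBranch_div_pos {k w : ℂ} (hk : k.im ≠ 0) (hw : w ∈ horizontalStrip k) :
    0 < (sqrtBranch k w / k).re := by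
  have hk0 : k ≠ 0 := fun h => hk (by simp [h])
  obtain ⟨h1, h2⟩ := Complex.mem_slitPlane_iff_arg.1 (one_sub_div_sq_mem_slitPlane hk hw)
  have h3 := Complex.neg_pi_lt_arg (1 - (w / k) ^ 2)
  have h4 := lt_of_le_of_ne (Complex.arg_le_pi (1 - (w / k) ^ 2)) h1
  rw [sqrtBranch, mul_div_cancel_left₀ _ hk0, Complex.exp_re]
  refine mul_pos (Real.exp_pos _) (Real.cos_pos_of_mem_Ioo ?_)
  rw [Complex.div_ofNat_im, Complex.log_im]
  constructor <;> linarith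

theorem isRootBranch_sqrtBranch {k : ℂ} (hk : k.im ≠ 0) : IsRootBranch k (sqrtBranch k) where
  continuousOn := by
    have h : ContinuousOn (fun w : ℂ => Complex.log (1 - (w / k) ^ 2)) (horizontalStrip k) :=
      ContinuousOn.clog (by fun_prop) fun w hw => one_sub_div_sq_mem_slitPlane hk hw
    unfold sqrtBranch
    fun_prop
  sq_eq := fun w hw => sqrtBranch_sq hk hw
  at_zero := by simp [sqrtBranch]

theorem convex_horizontalStrip (k : ℂ) : Convex ℝ (horizontalStrip k) := by
  have h : horizontalStrip k = Complex.imLm ⁻¹' (Metric.ball 0 |k.im|) := by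
    ext w
    simp [horizontalStrip]
  rw [h]
  exact (convex_ball _ _).linear_preimage _

/-- On a connected set, two continuous functions with equal squares, one of them nowhere zero,
coincide once they agree at a point. -/
theorem IsRootBranch.eqOn {k : ℂ} (hk : k.im ≠ 0) {t : ℂ → ℂ} (ht : IsRootBranch k t) :
    EqOn t (sqrtBranch k) (horizontalStrip k) := by
  have hs := isRootBranch_sqrtBranch hk
  refine (convex_horizontalStrip k).isPreconnected.eq_of_sq_eq ht.continuousOn hs.continuousOn
    (fun w hw => ?_) (fun _ => sqrtBranch_ne_zero hk) (y := 0) ?_ (ht.at_zero.trans hs.at_zero.symm)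
  · exact (ht.sq_eq w hw).trans (hs.sq_eq w hw).symm
  · simpa [horizontalStrip] using hk

/-! ### Evaluation of the transform -/

theorem integrableOn_and_hankelCosTransform_eq {k w : ℂ} (hre : 0 < k.re) (him : k.im < 0)
    (hw : w ∈ horizontalStrip k) :
    IntegrableOn (fun x : ℝ => hankelH2Zero (k * x) * Complex.cos (w * x)) (Ioi 0) ∧
      hankelCosTransform k w = 1 / sqrtBranch k w := by
  have hk0 : k ≠ 0 := ne_zero_of_re_pos hre
  have hs0 : sqrtBranch k w ≠ 0 := sqrtBranch_ne_zero him.ne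
  have hpi : (Real.pi : ℂ) ≠ 0 := by exact_mod_cast Real.pi_ne_zero
  have ha : (Complex.I * k).re = |k.im| := by rw [abs_of_neg him]; simp
  have hwa : |w.im| < (Complex.I * k).re := by rw [ha]; exact hw
  have hF := integrable_macdonald_mul_cos hwa
  have hinner : ∀ x : ℝ, 0 < x → hankelH2Zero (k * x) * Complex.cos (w * x)
      = 2 * Complex.I / Real.pi * ∫ t in Ioi (0 : ℝ),
        Complex.exp (-(Complex.I * k * Real.cosh t * x)) * Complex.cos (w * x) := by
    intro x hx
    rw [hankelH2Zero_eq_macdonaldIntegral (by simpa using mul_pos hre hx)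
      (by simpa using mul_neg_of_neg_of_pos him hx), integral_mul_const, mul_assoc,
      macdonaldIntegral]
    congr 3
    funext t
    rw [pow_zero, one_mul]
    ring_nf
  set r := sqrtBranch k w / k with hr
  have hr2 : k ^ 2 * r ^ 2 = k ^ 2 - w ^ 2 := by
    rw [hr, div_pow, mul_div_cancel₀ _ (pow_ne_zero 2 hk0), sqrtBranch_sq him.ne hw]
  have houter : ∀ t : ℝ, ∫ x in Ioi (0 : ℝ),
      Complex.exp (-(Complex.I * k * Real.cosh t * x)) * Complex.cos (w * x)
        = -Complex.I / k * ((Real.cosh t : ℂ) / (r ^ 2 + (Real.sinh t : ℂ) ^ 2)) := by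
    intro t
    have hlt : |w.im| < (Complex.I * k * Real.cosh t).re := by
      rw [Complex.re_mul_ofReal]
      exact hwa.trans_le (le_mul_of_one_le_right (ha ▸ abs_nonneg _) (Real.one_le_cosh t))
    have hden : (Complex.I * k * Real.cosh t) ^ 2 + w ^ 2
        = -(k ^ 2 * (r ^ 2 + (Real.sinh t : ℂ) ^ 2)) := by
      have h3 : (Real.cosh t : ℂ) ^ 2 = (Real.sinh t : ℂ) ^ 2 + 1 := by
        exact_mod_cast Real.cosh_sq t
      linear_combination (k ^ 2 * (Real.cosh t : ℂ) ^ 2) * Complex.I_sq - k ^ 2 * h3 + hr2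
    rw [integral_cos_mul_exp hlt, hden, div_neg, div_mul_div_comm, mul_comm (k ^ 2), pow_two k,
      ← mul_assoc _ k k, mul_right_comm Complex.I k, mul_div_mul_right _ _ hk0]
    ring
  -- Fubini already makes the inner integral integrable in `t`; undoing the constant `-i/k`
  -- suffices.
  have hint : IntegrableOn
      (fun t : ℝ => (Real.cosh t : ℂ) / (r ^ 2 + (Real.sinh t : ℂ) ^ 2)) (Ioi 0) := by
    have h := hF.integral_prod_right
    simp_rw [houter] at h
    refine (h.const_mul (k * Complex.I)).congr (ae_of_all _ fun t => ?_)
    have : k * Complex.I * (-Complex.I / k) = 1 := by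
      field_simp; linear_combination -Complex.I_sq
    simp only [← mul_assoc, this, one_mul]
  refine ⟨(hF.integral_prod_left.const_mul (2 * Complex.I / Real.pi)).congr ?_, ?_⟩
  · filter_upwards [ae_restrict_mem measurableSet_Ioi] with x hx
    exact (hinner x hx).symm
  · rw [hankelCosTransform, setIntegral_congr_fun measurableSet_Ioi hinner, integral_const_mul,
      integral_integral_swap hF]
    simp_rw [houter]
    rw [integral_const_mul,
      integral_cosh_div_sq_add_sinh_sq (re_sqrtBranch_div_pos him.ne hw) hint]
    -- The constants combine as `(2i/π)(-i/k)(π/(2r)) = 1/(kr)`.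
    field_simp
    linear_combination -Complex.I_sq

theorem mainTheorem1 (k : ℂ) (hre : 0 < k.re) (him : k.im < 0) :
    ∃ s : ℂ → ℂ, IsRootBranch k s ∧
      (∀ t : ℂ → ℂ, IsRootBranch k t → Set.EqOn t s (horizontalStrip k)) ∧
      ∀ w ∈ horizontalStrip k,
        MeasureTheory.IntegrableOn
          (fun x : ℝ => hankelH2Zero (k * (x : ℂ)) * Complex.cos (w * (x : ℂ)))
          (Set.Ioi (0 : ℝ)) ∧
        hankelCosTransform k w = 1 / s w :=
  ⟨sqrtBranch k, isRootBranch_sqrtBranch him.ne, fun _ ht => ht.eqOn him.ne,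
    fun _ hw => integrableOn_and_hankelCosTransform_eq hre him hw⟩
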